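/- Let $N\ge 1$ and $2<p_1\le p_2\le\dots\le p_N$ be real, and put $q=\frac1N\sum_{i=1}^N p_i$. Let $g\in L^1_{\mathrm{loc}}(\mathbb R^N)$ satisfy $g\ge c$ a.e. for some constant $c>0$, let $1\le\delta<\gamma$, and put $f(t)=-(t^{-\delta}+t^{-\gamma})$ for $t>0$. Assume that $p_i(N(q-1)+4)-N^2(q-1)>0$ for all $i=1,\dots,N$ and that $\delta\in A\cap I$, where $$A=\Big(\frac{N(q-1)(p_N-1)}{4},\infty\Big),\qquad I=\bigcap_{i=1}^N\Big(\frac{N^2(q-1)(p_i-1)}{p_i(N(q-1)+4)-N^2(q-1)},\infty\Big).$$ Let $W^{1,p_i}_{\mathrm{loc}}(\mathbb R^N)$ be the space of all $u\in W^{1,1}_{\mathrm{loc}}(\mathbb R^N)$ whose weak partial derivatives satisfy $\frac{\partial u}{\partial x_i}\in L^{p_i}_{\mathrm{loc}}(\mathbb R^N)$ for $i=1,\dots,N$. A function $u\in W^{1,p_i}_{\mathrm{loc}}(\mathbb R^N)$ with $u>0$ a.e. is called a stable solution of $$-\sum_{i=1}^N\frac{\partial}{\partial x_i}\Big(\Big|\frac{\partial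 u}{\partial x_i}\Big|^{p_i-2}\frac{\partial u}{\partial x_i}\Big)=g(x)f(u)\ \text{ in }\mathbb R^N \tag{1}$$ if $g\,f(u)$ and $g\,f'(u)$ belong to $L^1_{\mathrm{loc}}(\mathbb R^N)$ and, for all $\varphi\in C^1_c(\mathbb R^N)$, $$\sum_{i=1}^N\int_{\mathbb R^N}\Big|\frac{\partial u}{\partial x_i}\Big|^{p_i-2}\frac{\partial u}{\partial x_i}\frac{\partial\varphi}{\partial x_i}\,dx=\int_{\mathbb R^N}g\,f(u)\,\varphi\,dx$$ and $$\int_{\mathbb R^N}g\,f'(u)\,\varphi^2\,dx\le\sum_{i=1}^N(p_i-1)\int_{\mathbb R^N}\Big|\frac{\partial u}{\partial x_i}\Big|^{p_i-2}\Big|\frac{\partial\varphi}{\partial x_i}\Big|^2\,dx.$$ If $u\in W^{1,p_i}_{\mathrm{loc}}(\mathbb R^N)$ satisfies $0<u\le1$ a.e. in $\mathbb R^N$, then $u$ is not a stable solution of (1). -/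

import Mathlib

open MeasureTheory

noncomputable section

/-- The partial derivative `∂φ/∂xᵢ` of a (differentiable) function on `ℝᴺ`. -/
def partialDeriv {N : ℕ} (i : Fin N) (φ : EuclideanSpace ℝ (Fin N) → ℝ)
    (x : EuclideanSpace ℝ (Fin N)) : ℝ :=
  fderiv ℝ φ x (EuclideanSpace.single i 1)

/-- `v` is the weak partial derivative `∂u/∂xᵢ` of `u` on `ℝᴺ`: both functions are locally
integrable and `∫ u ∂φ/∂xᵢ = -∫ v φ` for all `φ ∈ C_c^∞(ℝᴺ)`. -/
def HasWeakPartialDeriv {N : ℕ} (i : Fin N) (u v : EuclideanSpace ℝ (Fin N) → ℝ) : Prop :=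
  LocallyIntegrable u volume ∧ LocallyIntegrable v volume ∧
    ∀ φ : EuclideanSpace ℝ (Fin N) → ℝ, ContDiff ℝ (⊤ : ℕ∞) φ → HasCompactSupport φ →
      ∫ x, u x * partialDeriv i φ x = -∫ x, v x * φ x

/-- `Du = (u₁, …, u_N)` is the weak gradient of `u`, and `uᵢ ∈ L^{pᵢ}_loc(ℝᴺ)` for every `i`. -/
def HasAnisotropicWeakGradient {N : ℕ} (p : Fin N → ℝ) (u : EuclideanSpace ℝ (Fin N) → ℝ)
    (Du : Fin N → EuclideanSpace ℝ (Fin N) → ℝ) : Prop :=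
  ∀ i, HasWeakPartialDeriv i u (Du i) ∧
    ∀ K : Set (EuclideanSpace ℝ (Fin N)), IsCompact K →
      MemLp (Du i) (ENNReal.ofReal (p i)) (volume.restrict K)

/-- The local anisotropic Sobolev space `W^{1,pᵢ}_loc(ℝᴺ)`: the functions in `W^{1,1}_loc(ℝᴺ)`
whose `i`-th weak partial derivative lies in `L^{pᵢ}_loc(ℝᴺ)` for every `i`. -/
def MemAnisotropicSobolevLoc {N : ℕ} (p : Fin N → ℝ)
    (u : EuclideanSpace ℝ (Fin N) → ℝ) : Prop :=
  LocallyIntegrable u volume ∧ ∃ Du, HasAnisotropicWeakGradient p u Du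

/-- `u` is a stable solution of `-∑ᵢ ∂ᵢ(|∂ᵢu|^{pᵢ-2} ∂ᵢu) = g f(u)`, `u > 0`, in `ℝᴺ`: it lies in
`W^{1,pᵢ}_loc(ℝᴺ)`, is positive a.e., `g f(u)` and `g f'(u)` are locally integrable, and the weak
formulation and the stability inequality hold for all test functions `φ ∈ C_c¹(ℝᴺ)`. The weak
gradient `Du` is unique up to null sets, so the quantifier over it is immaterial. -/
def IsStableSolution {N : ℕ} (p : Fin N → ℝ) (g : EuclideanSpace ℝ (Fin N) → ℝ) (f : ℝ → ℝ)
    (u : EuclideanSpace ℝ (Fin N) → ℝ) : Prop :=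
  LocallyIntegrable u volume ∧
  (∀ᵐ x ∂volume, 0 < u x) ∧
  LocallyIntegrable (fun x => g x * f (u x)) volume ∧
  LocallyIntegrable (fun x => g x * deriv f (u x)) volume ∧
  ∃ Du : Fin N → EuclideanSpace ℝ (Fin N) → ℝ,
    HasAnisotropicWeakGradient p u Du ∧
    (∀ φ : EuclideanSpace ℝ (Fin N) → ℝ, ContDiff ℝ 1 φ → HasCompactSupport φ →
      ∑ i, ∫ x, |Du i x| ^ (p i - 2) * Du i x * partialDeriv i φ x
        = ∫ x, g x * f (u x) * φ x) ∧
    (∀ φ : EuclideanSpace ℝ (Fin N) → ℝ, ContDiff ℝ 1 φ → HasCompactSupport φ →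
      ∫ x, g x * deriv f (u x) * φ x ^ 2
        ≤ ∑ i, (p i - 1) * ∫ x, |Du i x| ^ (p i - 2) * |partialDeriv i φ x| ^ 2)

/-- The nonlinearity `f(t) = -(t^{-δ} + t^{-γ})`, evaluated only at `t > 0`. -/
def singularNonlinearity (δ γ : ℝ) (t : ℝ) : ℝ := -(t ^ (-δ) + t ^ (-γ))

/-- The arithmetic mean `q` of `p₁, …, p_N`. -/
def meanExponent {N : ℕ} (p : Fin N → ℝ) : ℝ := (∑ i, p i) / N

/-- The last exponent `p_N`. -/
def lastExponent {N : ℕ} [NeZero N] (p : Fin N → ℝ) : ℝ :=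
  p ⟨N - 1, Nat.sub_lt (NeZero.pos N) Nat.one_pos⟩

/-- The interval `A = (N(q-1)(p_N-1)/4, ∞)`. -/
def intervalA {N : ℕ} [NeZero N] (p : Fin N → ℝ) : Set ℝ :=
  Set.Ioi (N * (meanExponent p - 1) * (lastExponent p - 1) / 4)

/-- The denominator `pᵢ(N(q-1)+4) - N²(q-1)` of the endpoint of `Iᵢ`. -/
def denomI {N : ℕ} (p : Fin N → ℝ) (i : Fin N) : ℝ :=
  p i * (N * (meanExponent p - 1) + 4) - N ^ 2 * (meanExponent p - 1)

/-- The intersection `I` of the intervals `Iᵢ = (N²(q-1)(pᵢ-1) / (pᵢ(N(q-1)+4) - N²(q-1)), ∞)`;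
it is used only when all the denominators are positive. -/
def intervalI {N : ℕ} (p : Fin N → ℝ) : Set ℝ :=
  ⋂ i, Set.Ioi (N ^ 2 * (meanExponent p - 1) * (p i - 1) / denomI p i)

end

/-! Stability forces a lower bound of volume order that the energy of u cannot match. Since 0 < u ≤
1, f'(u) ≥ δ, so for a cutoff η at scale R the left side of the stability inequality tested with
η^(j+1) is at least cδ|B_R|. Its right side is controlled by ∑ ∫ |∂ᵢu|^{pᵢ} η^(2j+2) plus
b^{pᵢ}|B_{2R}|, where b is of order 1/R.

That energy is bounded by a Caccioppoli inequality: f ≤ 0 makes u a subsolution, so testing the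
equation with u η^(2j+2) discards the right side, and |u| ≤ 1 lets the gradient of the cutoff be
absorbed (`caccioppoli`). As pᵢ > 2, everything is at most C b²|B_R|. Dividing by |B_R| gives cδ ≤ C
b² (`stable_solution_decay`), and b → 0 is a contradiction.

The technical point is that only C¹ test functions are allowed, whereas u η^(2j+2) is merely
Sobolev. `weak_equation_test_self` mollifies u: the mollified gradients converge weakly against the
flux |∂ᵢu|^{pᵢ-2}∂ᵢu, which lies in the dual space. -/

open Filter Topology ContinuousLinearMap
open scoped ENNReal Convolution

/-! ### Weak convergence of mollifications -/

section Mollification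

variable {E : Type*} [NormedAddCommGroup E] [NormedSpace ℝ E] [FiniteDimensional ℝ E]
  [MeasurableSpace E] [BorelSpace E] {μ : Measure E} [μ.IsAddHaarMeasure]

/-- Translations act continuously on `Lᵖ`. -/
theorem tendsto_eLpNorm_translate_sub {p : ℝ≥0∞} (hp1 : 1 ≤ p) (hp : p ≠ ∞) {V : E → ℝ}
    (hV : MemLp V p μ) :
    Tendsto (fun y => eLpNorm (fun x => V (x - y) - V x) p μ) (𝓝 0) (𝓝 0) := by
  have : Fact (1 ≤ p) := ⟨hp1⟩
  let T : E → C(E, E) := fun y => ⟨fun x => x - y, by fun_prop⟩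
  have hT : Continuous T := by
    refine ContinuousMap.continuous_of_continuous_uncurry _ ?_
    change Continuous fun q : E × E => q.2 - q.1
    fun_prop
  have hTm : ∀ y, MeasurePreserving (T y) μ μ := fun y => measurePreserving_sub_right μ y
  -- Composition with a continuous family of measure-preserving maps is continuous in `Lp`; this
  -- needs p < ∞.
  have h1 : Continuous fun y => Lp.compMeasurePreserving (T y) (hTm y) (hV.toLp V) :=
    continuous_const.compMeasurePreservingLp hT hTm hp
  have h2 : Tendsto (fun y => ‖Lp.compMeasurePreserving (T y) (hTm y) (hV.toLp V) - hV.toLp V‖ₑ)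
      (𝓝 0) (𝓝 0) := by
    have h3 : Continuous fun y =>
        ‖Lp.compMeasurePreserving (T y) (hTm y) (hV.toLp V) - hV.toLp V‖ₑ := by fun_prop
    have h4 := h3.tendsto 0
    have h0 : Lp.compMeasurePreserving (T 0) (hTm 0) (hV.toLp V) = hV.toLp V := by
      rw [Lp.toLp_compMeasurePreserving]
      congr 1
      ext x
      simp [T]
    simpa [h0] using h4
  refine h2.congr fun y => ?_
  rw [Lp.toLp_compMeasurePreserving, ← MemLp.toLp_sub, Lp.enorm_toLp]
  rfl

/-- The mollification error is controlled by the translation error. -/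
theorem lintegral_mul_convolution_sub_le {p q : ℝ≥0∞} [p.HolderConjugate q]
    {V w : E → ℝ} (hV : MemLp V p μ) (hVl : LocallyIntegrable V μ) (hw : MemLp w q μ)
    (φ : ContDiffBump (0 : E)) {ε : ℝ≥0∞}
    (hε : ∀ y ∈ Metric.ball (0 : E) φ.rOut, eLpNorm (fun x => V (x - y) - V x) p μ ≤ ε) :
    ∫⁻ x, ‖w x * (φ.normed μ ⋆[lsmul ℝ ℝ, μ] V) x - w x * V x‖ₑ ∂μ ≤ eLpNorm w q μ * ε := by
  have hconv : ConvolutionExists (φ.normed μ) V (lsmul ℝ ℝ) μ :=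
    φ.hasCompactSupport_normed.convolutionExists_left _ φ.continuous_normed hVl
  -- The kernel has mass one, so w V can be moved under the convolution integral. Tonelli and Hölder
  -- in x, for each fixed y, then give the bound.
  have hpt : ∀ x, ‖w x * (φ.normed μ ⋆[lsmul ℝ ℝ, μ] V) x - w x * V x‖ₑ
      ≤ ∫⁻ y, ‖φ.normed μ y‖ₑ * ‖w x * (V (x - y) - V x)‖ₑ ∂μ := by
    intro x
    have hi : Integrable (fun y => φ.normed μ y * V (x - y)) μ := hconv x
    have : w x * (φ.normed μ ⋆[lsmul ℝ ℝ, μ] V) x - w x * V x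
        = ∫ y, φ.normed μ y * (w x * (V (x - y) - V x)) ∂μ := by
      have e1 : ∀ y, φ.normed μ y * (w x * (V (x - y) - V x))
          = w x * (φ.normed μ y * V (x - y)) - (w x * V x) * φ.normed μ y := fun y => by ring
      simp_rw [e1]
      rw [integral_sub (hi.const_mul _) (φ.integrable_normed.const_mul _), integral_const_mul,
        integral_const_mul, φ.integral_normed, mul_one]
      rfl
    rw [this]
    refine (enorm_integral_le_lintegral_enorm _).trans (le_of_eq ?_)
    simp_rw [enorm_mul]
  refine (lintegral_mono hpt).trans ?_
  have hVm := hV.aestronglyMeasurable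
  have hVsub : AEStronglyMeasurable (fun z : E × E => V (z.1 - z.2)) (μ.prod μ) :=
    hVm.comp_quasiMeasurePreserving (quasiMeasurePreserving_sub μ μ)
  rw [lintegral_lintegral_swap]
  swap
  · have m1 : AEStronglyMeasurable (fun z : E × E => φ.normed μ z.2) (μ.prod μ) :=
      (φ.continuous_normed.comp continuous_snd).aestronglyMeasurable
    have m2 : AEStronglyMeasurable (fun z : E × E => w z.1 * (V (z.1 - z.2) - V z.1))
        (μ.prod μ) := hw.aestronglyMeasurable.comp_fst.mul (hVsub.sub hVm.comp_fst)
    exact m1.enorm.mul m2.enorm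
  have hinner : ∀ y, ∫⁻ x, ‖φ.normed μ y‖ₑ * ‖w x * (V (x - y) - V x)‖ₑ ∂μ
      ≤ ‖φ.normed μ y‖ₑ * (eLpNorm w q μ * ε) := by
    intro y
    rw [lintegral_const_mul' _ _ enorm_ne_top]
    by_cases hy : y ∈ Metric.ball (0 : E) φ.rOut
    · gcongr
      have hVy : AEStronglyMeasurable (fun x => V (x - y) - V x) μ :=
        (hVm.comp_measurePreserving (measurePreserving_sub_right μ y)).sub hVm
      have hH := eLpNorm_smul_le_mul_eLpNorm (p := q) (q := p) (r := 1) hVy hw.1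
      rw [eLpNorm_one_eq_lintegral_enorm] at hH
      refine hH.trans ?_
      gcongr
      exact hε y hy
    · have : φ.normed μ y = 0 := by
        rw [← Function.notMem_support, φ.support_normed_eq]
        exact hy
      simp [this]
  refine (lintegral_mono hinner).trans ?_
  rw [lintegral_mul_const'' _ φ.continuous_normed.aestronglyMeasurable.enorm]
  have h1 : ∫⁻ y, ‖φ.normed μ y‖ₑ ∂μ = 1 := by
    have := ofReal_integral_eq_lintegral_ofReal (φ.integrable_normed (μ := μ))
      (Eventually.of_forall φ.nonneg_normed)
    rw [φ.integral_normed, ENNReal.ofReal_one] at this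
    rw [this]
    exact lintegral_congr fun y => Real.enorm_of_nonneg (φ.nonneg_normed y)
  rw [h1, one_mul]

/-- Mollifications of an `Lᵖ` function converge weakly against `L^q` functions. -/
theorem tendsto_integral_mul_convolution {p q : ℝ≥0∞} [p.HolderConjugate q] (hp : p ≠ ∞)
    {V w : E → ℝ} (hV : MemLp V p μ) (hw : MemLp w q μ)
    {φ : ℕ → ContDiffBump (0 : E)} (hφ : Tendsto (fun n => (φ n).rOut) atTop (𝓝 0)) :
    Tendsto (fun n => ∫ x, w x * ((φ n).normed μ ⋆[lsmul ℝ ℝ, μ] V) x ∂μ) atTop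
      (𝓝 (∫ x, w x * V x ∂μ)) := by
  have hp1 : 1 ≤ p := ENNReal.HolderConjugate.one_le p q
  have hVl : LocallyIntegrable V μ := hV.locallyIntegrable hp1
  have hwV : Integrable (fun x => w x * V x) μ := hw.integrable_mul hV
  have hlim : Tendsto (fun n => ∫⁻ x, ‖w x * ((φ n).normed μ ⋆[lsmul ℝ ℝ, μ] V) x
      - w x * V x‖ₑ ∂μ) atTop (𝓝 0) := by
    have htr := tendsto_eLpNorm_translate_sub hp1 hp hV
    rw [ENNReal.tendsto_nhds_zero] at htr ⊢
    intro ε hε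
    obtain ⟨η, hη, hηε⟩ : ∃ η : ℝ≥0∞, 0 < η ∧ eLpNorm w q μ * η ≤ ε := by
      rcases eq_or_ne (eLpNorm w q μ) 0 with h0 | h0
      · exact ⟨1, one_pos, by simp [h0]⟩
      · exact ⟨ε / eLpNorm w q μ, ENNReal.div_pos hε.ne' hw.2.ne, ENNReal.mul_div_le⟩
    obtain ⟨r, hr, hball⟩ := Metric.eventually_nhds_iff_ball.1 (htr η hη)
    filter_upwards [hφ.eventually_lt_const hr] with n hn
    refine (lintegral_mul_convolution_sub_le hV hVl hw (φ n) fun y hy => ?_).trans hηε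
    exact hball y (Metric.ball_subset_ball hn.le hy)
  refine tendsto_integral_of_L1 _ hwV.1 ?_ hlim
  -- An L¹ distance below 1 is finite, which already makes the mollified product integrable.
  filter_upwards [hlim.eventually_lt_const one_pos] with n hn
  have hc : Continuous ((φ n).normed μ ⋆[lsmul ℝ ℝ, μ] V) :=
    (φ n).hasCompactSupport_normed.continuous_convolution_left _ (φ n).continuous_normed hVl
  have hd : Integrable (fun x => w x * ((φ n).normed μ ⋆[lsmul ℝ ℝ, μ] V) x - w x * V x) μ :=
    ⟨(hw.1.mul hc.aestronglyMeasurable).sub hwV.1, hn.trans ENNReal.one_lt_top⟩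
  exact (hd.add hwV).congr (Eventually.of_forall fun x => by simp)

/-- A mollification on a ball only depends on the function on a slightly larger ball. -/
theorem convolution_indicator_closedBall (φ : ContDiffBump (0 : E)) {v : E → ℝ} {r s : ℝ}
    (hrs : r + φ.rOut ≤ s) {x : E} (hx : x ∈ Metric.closedBall (0 : E) r) :
    (φ.normed μ ⋆[lsmul ℝ ℝ, μ] (Metric.closedBall (0 : E) s).indicator v) x
      = (φ.normed μ ⋆[lsmul ℝ ℝ, μ] v) x := by
  refine integral_congr_ae (Eventually.of_forall fun y => ?_)
  by_cases hy : y ∈ Metric.ball (0 : E) φ.rOut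
  · have hxy : x - y ∈ Metric.closedBall (0 : E) s := by
      rw [mem_closedBall_zero_iff] at hx ⊢
      rw [mem_ball_zero_iff] at hy
      linarith [norm_sub_le x y]
    simp [Set.indicator_of_mem hxy]
  · have : φ.normed μ y = 0 := by
      rw [← Function.notMem_support, φ.support_normed_eq]
      exact hy
    simp [this]

/-- Mollifications of an `Lᵖ_loc` function converge weakly against compactly supported `L^q`
functions. -/
theorem tendsto_integral_mul_convolution_of_local {p q : ℝ≥0∞} [p.HolderConjugate q]
    (hp : p ≠ ∞) {v w : E → ℝ}
    (hv : ∀ K : Set E, IsCompact K → MemLp v p (μ.restrict K)) (hw : MemLp w q μ) {r : ℝ}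
    (hwr : ∀ x, x ∉ Metric.closedBall (0 : E) r → w x = 0)
    {φ : ℕ → ContDiffBump (0 : E)} (hφ : Tendsto (fun n => (φ n).rOut) atTop (𝓝 0)) :
    Tendsto (fun n => ∫ x, w x * ((φ n).normed μ ⋆[lsmul ℝ ℝ, μ] v) x ∂μ) atTop
      (𝓝 (∫ x, w x * v x ∂μ)) := by
  -- The margin 1 eventually exceeds the mollification radius, so truncating v is invisible on the
  -- ball of radius r.
  have hV : MemLp ((Metric.closedBall (0 : E) (r + 1)).indicator v) p μ :=
    (memLp_indicator_iff_restrict Metric.isClosed_closedBall.measurableSet).2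
      (hv _ (isCompact_closedBall _ _))
  have h := tendsto_integral_mul_convolution hp hV hw hφ
  have hlim : ∫ x, w x * (Metric.closedBall (0 : E) (r + 1)).indicator v x ∂μ
      = ∫ x, w x * v x ∂μ := by
    refine integral_congr_ae (Eventually.of_forall fun x => ?_)
    by_cases hx : x ∈ Metric.closedBall (0 : E) r
    · simp [Set.indicator_of_mem (Metric.closedBall_subset_closedBall (by linarith) hx :
        x ∈ Metric.closedBall (0 : E) (r + 1))]
    · simp [hwr x hx]
  rw [hlim] at h
  refine h.congr' ?_
  filter_upwards [hφ.eventually_lt_const one_pos] with n hn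
  refine integral_congr_ae (Eventually.of_forall fun x => ?_)
  by_cases hx : x ∈ Metric.closedBall (0 : E) r
  · simp only
    rw [convolution_indicator_closedBall (φ n) (by linarith) hx]
  · simp [hwr x hx]

/-- Mollification does not increase the sup norm. -/
theorem abs_convolution_normed_le (φ : ContDiffBump (0 : E)) {u : E → ℝ} {M : ℝ}
    (hu : ∀ᵐ x ∂μ, |u x| ≤ M) (x : E) : |(φ.normed μ ⋆[lsmul ℝ ℝ, μ] u) x| ≤ M := by
  have hu' : ∀ᵐ y ∂μ, |u (x - y)| ≤ M :=
    (quasiMeasurePreserving_sub_left_of_right_invariant μ x).ae hu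
  have := norm_integral_le_of_norm_le (f := fun y => φ.normed μ y * u (x - y))
    (φ.integrable_normed.mul_const M)
    (hu'.mono fun y hy => by
      rw [norm_mul, Real.norm_of_nonneg (φ.nonneg_normed y)]
      exact mul_le_mul_of_nonneg_left hy (φ.nonneg_normed y))
  rw [integral_mul_const, φ.integral_normed, one_mul] at this
  exact this

/-- Mollifications of a bounded function converge weakly against integrable functions. -/
theorem tendsto_integral_mul_convolution_of_bounded {F u : E → ℝ} {M : ℝ}
    (hF : Integrable F μ) (hul : LocallyIntegrable u μ) (hu : ∀ᵐ x ∂μ, |u x| ≤ M)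
    {φ : ℕ → ContDiffBump (0 : E)} (hφ : Tendsto (fun n => (φ n).rOut) atTop (𝓝 0))
    {K : ℝ} (hK : ∀ᶠ n in atTop, (φ n).rOut ≤ K * (φ n).rIn) :
    Tendsto (fun n => ∫ x, F x * ((φ n).normed μ ⋆[lsmul ℝ ℝ, μ] u) x ∂μ) atTop
      (𝓝 (∫ x, F x * u x ∂μ)) := by
  refine tendsto_integral_of_dominated_convergence (fun x => |F x| * M) (fun n => ?_)
    (hF.abs.mul_const M) (fun n => Eventually.of_forall fun x => ?_) ?_
  · exact hF.1.mul ((φ n).hasCompactSupport_normed.continuous_convolution_left _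
      (φ n).continuous_normed hul).aestronglyMeasurable
  · rw [norm_mul]
    exact mul_le_mul_of_nonneg_left (abs_convolution_normed_le (φ n) hu x) (abs_nonneg _)
  -- Convergence at Lebesgue points; the bound K on the radius ratio keeps the kernels comparable to
  -- ball averages.
  · filter_upwards [ContDiffBump.ae_convolution_tendsto_right_of_locallyIntegrable hφ hK hul]
      with x hx
    exact hx.const_mul _

end Mollification

/-! ### Partial derivatives: mollification, products, powers -/

/-- The mollification of a weak derivative is the derivative of the mollification. -/
theorem HasWeakPartialDeriv.partialDeriv_convolution {N : ℕ} {i : Fin N}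
    {u v : EuclideanSpace ℝ (Fin N) → ℝ} (h : HasWeakPartialDeriv i u v)
    (φ : ContDiffBump (0 : EuclideanSpace ℝ (Fin N))) (x : EuclideanSpace ℝ (Fin N)) :
    partialDeriv i (φ.normed volume ⋆[lsmul ℝ ℝ, volume] u) x
      = (φ.normed volume ⋆[lsmul ℝ ℝ, volume] v) x := by
  obtain ⟨hu, -, hweak⟩ := h
  have hρ : ContDiff ℝ (⊤ : ℕ∞) (φ.normed volume) := φ.contDiff_normed
  have hρ1 : ContDiff ℝ 1 (φ.normed volume) := φ.contDiff_normed
  have hfd := φ.hasCompactSupport_normed.hasFDerivAt_convolution_left (lsmul ℝ ℝ) hρ1 hu x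
  set e : EuclideanSpace ℝ (Fin N) := EuclideanSpace.single i 1
  have hex : Integrable (fun t => (lsmul ℝ ℝ).precompL (EuclideanSpace ℝ (Fin N))
      (fderiv ℝ (φ.normed volume) t) (u (x - t))) volume :=
    (φ.hasCompactSupport_normed.fderiv (𝕜 := ℝ)).convolutionExists_left
      ((lsmul ℝ ℝ : ℝ →L[ℝ] ℝ →L[ℝ] ℝ).precompL (EuclideanSpace ℝ (Fin N)))
      (hρ1.continuous_fderiv one_ne_zero) hu x
  have h1 : partialDeriv i (φ.normed volume ⋆[lsmul ℝ ℝ, volume] u) x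
      = ∫ t, fderiv ℝ (φ.normed volume) t e * u (x - t) := by
    rw [partialDeriv, hfd.fderiv, convolution_def, ContinuousLinearMap.integral_apply hex]
    rfl
  have h2 : ∫ t, fderiv ℝ (φ.normed volume) t e * u (x - t)
      = ∫ y, fderiv ℝ (φ.normed volume) (x - y) e * u y := by
    rw [← integral_sub_left_eq_self (fun t => fderiv ℝ (φ.normed volume) t e * u (x - t))
      volume x]
    simp
  have hd : ∀ y, partialDeriv i (fun y => φ.normed volume (x - y)) y
      = -fderiv ℝ (φ.normed volume) (x - y) e := by
    intro y
    have := ((hρ1.differentiable one_ne_zero (x - y)).hasFDerivAt).comp y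
      ((hasFDerivAt_id y).const_sub x)
    rw [partialDeriv]
    erw [this.fderiv]
    simp [e]
  -- The reflected kernel is the test function; the sign from reflection cancels the one in the weak
  -- derivative.
  have h3 := hweak (fun y => φ.normed volume (x - y)) (hρ.comp (contDiff_const.sub contDiff_id))
    (φ.hasCompactSupport_normed.comp_homeomorph (Homeomorph.subLeft x))
  simp_rw [hd] at h3
  rw [h1, h2, convolution_eq_swap]
  calc ∫ y, fderiv ℝ (φ.normed volume) (x - y) e * u y
      = -∫ y, u y * -fderiv ℝ (φ.normed volume) (x - y) e := by
        rw [← integral_neg]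
        exact integral_congr_ae (Eventually.of_forall fun y => by simp only; ring)
    _ = ∫ y, v y * φ.normed volume (x - y) := by rw [h3, neg_neg]
    _ = _ := integral_congr_ae (Eventually.of_forall fun y => by simp [mul_comm])

theorem partialDeriv_mul {N : ℕ} (i : Fin N) {f g : EuclideanSpace ℝ (Fin N) → ℝ}
    (hf : ContDiff ℝ 1 f) (hg : ContDiff ℝ 1 g) (x : EuclideanSpace ℝ (Fin N)) :
    partialDeriv i (fun y => f y * g y) x = partialDeriv i f x * g x + f x * partialDeriv i g x := by
  rw [partialDeriv, fderiv_fun_mul (hf.differentiable one_ne_zero x)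
    (hg.differentiable one_ne_zero x)]
  simp [partialDeriv]
  ring

theorem partialDeriv_pow {N : ℕ} (i : Fin N) {f : EuclideanSpace ℝ (Fin N) → ℝ}
    (hf : ContDiff ℝ 1 f) (k : ℕ) (x : EuclideanSpace ℝ (Fin N)) :
    partialDeriv i (fun y => f y ^ k) x = k * f x ^ (k - 1) * partialDeriv i f x := by
  rw [partialDeriv, fderiv_fun_pow _ (hf.differentiable one_ne_zero x)]
  simp [partialDeriv]

theorem continuous_partialDeriv {N : ℕ} (i : Fin N) {f : EuclideanSpace ℝ (Fin N) → ℝ}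
    (hf : ContDiff ℝ 1 f) : Continuous (partialDeriv i f) :=
  (hf.continuous_fderiv one_ne_zero).clm_apply continuous_const

theorem hasCompactSupport_partialDeriv {N : ℕ} (i : Fin N) {f : EuclideanSpace ℝ (Fin N) → ℝ}
    (hf : HasCompactSupport f) : HasCompactSupport (partialDeriv i f) :=
  (hf.fderiv (𝕜 := ℝ)).comp_left (g := fun L : EuclideanSpace ℝ (Fin N) →L[ℝ] ℝ =>
    L (EuclideanSpace.single i 1)) rfl

/-! ### The flux, and testing the equation with the solution -/

/-- The flux `|v|^{p-2} v` of an `Lᵖ_loc` function lies in `L^{p'}_loc`. -/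
theorem memLp_flux {α : Type*} [MeasurableSpace α] {μ : Measure α} {p : ℝ} (hp : 2 < p)
    {v : α → ℝ} (hv : MemLp v (ENNReal.ofReal p) μ) :
    MemLp (fun x => |v x| ^ (p - 2) * v x) (ENNReal.ofReal p.conjExponent) μ := by
  -- The flux has modulus |v|^(p-1), and p/(p-1) is the conjugate exponent.
  have h := hv.norm_rpow_div (ENNReal.ofReal (p - 1))
  rw [← ENNReal.ofReal_div_of_pos (by linarith), ENNReal.toReal_ofReal (by linarith)] at h
  have hm : AEStronglyMeasurable (fun x => |v x| ^ (p - 2) * v x) μ :=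
    (hv.1.norm.aemeasurable.pow_const (p - 2)).aestronglyMeasurable.mul hv.1
  refine h.congr_norm hm (Eventually.of_forall fun x => ?_)
  simp only [Real.norm_eq_abs, abs_mul]
  rw [abs_of_nonneg (Real.rpow_nonneg (abs_nonneg _) _),
    abs_of_nonneg (Real.rpow_nonneg (abs_nonneg _) _), ← Real.rpow_add_one' (abs_nonneg _)
      (by linarith)]
  congr 1
  ring

theorem locallyIntegrable_of_memLp_compact {N : ℕ} {v : EuclideanSpace ℝ (Fin N) → ℝ}
    {q : ℝ≥0∞} (hq : 1 ≤ q)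
    (hv : ∀ K : Set (EuclideanSpace ℝ (Fin N)), IsCompact K → MemLp v q (volume.restrict K)) :
    LocallyIntegrable v volume := by
  rw [locallyIntegrable_iff]
  intro K hK
  have : IsFiniteMeasure (volume.restrict K) := ⟨by simpa using hK.measure_lt_top⟩
  exact (hv K hK).integrable hq

/-- The weak equation tested with `u ψ`, for a bounded `u`. -/
theorem weak_equation_test_self {N : ℕ} {p : Fin N → ℝ} (hp : ∀ i, 2 < p i)
    {u h : EuclideanSpace ℝ (Fin N) → ℝ} {Du : Fin N → EuclideanSpace ℝ (Fin N) → ℝ}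
    (hDu : HasAnisotropicWeakGradient p u Du) (hul : LocallyIntegrable u volume)
    {M : ℝ} (hu : ∀ᵐ x ∂volume, |u x| ≤ M) (hh : LocallyIntegrable h volume)
    (heq : ∀ φ : EuclideanSpace ℝ (Fin N) → ℝ, ContDiff ℝ 1 φ → HasCompactSupport φ →
      ∑ i, ∫ x, |Du i x| ^ (p i - 2) * Du i x * partialDeriv i φ x = ∫ x, h x * φ x)
    {ψ : EuclideanSpace ℝ (Fin N) → ℝ} (hψ : ContDiff ℝ 1 ψ) (hψc : HasCompactSupport ψ) :
    ∑ i, ((∫ x, |Du i x| ^ (p i - 2) * Du i x * ψ x * Du i x)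
      + ∫ x, |Du i x| ^ (p i - 2) * Du i x * partialDeriv i ψ x * u x)
      = ∫ x, h x * ψ x * u x := by
  let φ : ℕ → ContDiffBump (0 : EuclideanSpace ℝ (Fin N)) := fun n =>
    ⟨1 / ((n : ℝ) + 1), 2 * (1 / ((n : ℝ) + 1)), by positivity, by
      have : 0 < 1 / ((n : ℝ) + 1) := by positivity
      linarith⟩
  have hφ : Tendsto (fun n => (φ n).rOut) atTop (𝓝 0) := by
    simpa [φ] using! tendsto_one_div_add_atTop_nhds_zero_nat.const_mul (2 : ℝ)
  have hφK : ∀ᶠ n in atTop, (φ n).rOut ≤ 2 * (φ n).rIn := Eventually.of_forall fun n => le_rfl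
  let U : ℕ → EuclideanSpace ℝ (Fin N) → ℝ := fun n =>
    (φ n).normed volume ⋆[lsmul ℝ ℝ, volume] u
  let V : ℕ → Fin N → EuclideanSpace ℝ (Fin N) → ℝ := fun n i =>
    (φ n).normed volume ⋆[lsmul ℝ ℝ, volume] (Du i)
  have hU : ∀ n, ContDiff ℝ 1 (U n) := fun n =>
    (φ n).hasCompactSupport_normed.contDiff_convolution_left (n := 1) _ (φ n).contDiff_normed hul
  have hV : ∀ n i, Continuous (V n i) := fun n i =>
    (φ n).hasCompactSupport_normed.continuous_convolution_left _ (φ n).continuous_normed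
      (hDu i).1.2.1
  have hconj : ∀ i, (p i).HolderConjugate (p i).conjExponent := fun i =>
    .conjExponent (by linarith [hp i])
  have hAq : ∀ i, ∀ K : Set (EuclideanSpace ℝ (Fin N)), IsCompact K →
      MemLp (fun x => |Du i x| ^ (p i - 2) * Du i x) (ENNReal.ofReal (p i).conjExponent)
        (volume.restrict K) := fun i K hK => memLp_flux (hp i) ((hDu i).2 K hK)
  have hAl : ∀ i, LocallyIntegrable (fun x => |Du i x| ^ (p i - 2) * Du i x) volume := fun i =>
    locallyIntegrable_of_memLp_compact
      (by simpa using ENNReal.ofReal_le_ofReal (hconj i).symm.lt.le) (hAq i)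
  have hA1 : ∀ n i, Integrable (fun x => |Du i x| ^ (p i - 2) * Du i x * ψ x * V n i x)
      volume := fun n i => by
    simpa only [smul_eq_mul, mul_assoc, Pi.mul_apply] using
      (hAl i).integrable_smul_right_of_hasCompactSupport (hψ.continuous.mul (hV n i))
        hψc.mul_right
  have hA2 : ∀ i, Integrable (fun x => |Du i x| ^ (p i - 2) * Du i x * partialDeriv i ψ x)
      volume := fun i => (hAl i).integrable_smul_right_of_hasCompactSupport
        (continuous_partialDeriv i hψ) (hasCompactSupport_partialDeriv i hψc)
  have hA3 : ∀ n i, Integrable (fun x => |Du i x| ^ (p i - 2) * Du i x * partialDeriv i ψ x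
      * U n x) volume := fun n i => by
    simpa only [smul_eq_mul, mul_assoc, Pi.mul_apply] using
      (hAl i).integrable_smul_right_of_hasCompactSupport
        ((continuous_partialDeriv i hψ).mul (hU n).continuous)
        (hasCompactSupport_partialDeriv i hψc).mul_right
  obtain ⟨r, hr⟩ := hψc.isCompact.isBounded.subset_closedBall 0
  have hψr : ∀ x, x ∉ Metric.closedBall (0 : EuclideanSpace ℝ (Fin N)) r → ψ x = 0 :=
    fun x hx => image_eq_zero_of_notMem_tsupport fun hx' => hx (hr hx')
  have hn : ∀ n, ∑ i, ((∫ x, |Du i x| ^ (p i - 2) * Du i x * ψ x * V n i x)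
      + ∫ x, |Du i x| ^ (p i - 2) * Du i x * partialDeriv i ψ x * U n x)
      = ∫ x, h x * ψ x * U n x := fun n => by
    -- With u mollified, the product with ψ is an admissible C¹ test function.
    have := heq (fun x => U n x * ψ x) ((hU n).mul hψ) hψc.mul_left
    rw [integral_congr_ae (g := fun x => h x * ψ x * U n x)
      (Eventually.of_forall fun x => by simp only; ring)] at this
    rw [← this]
    refine Finset.sum_congr rfl fun i _ => ?_
    rw [← integral_add (hA1 n i) (hA3 n i)]
    refine integral_congr_ae (Eventually.of_forall fun x => ?_)
    simp only
    rw [partialDeriv_mul i (hU n) hψ, (hDu i).1.partialDeriv_convolution (φ n) x]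
    ring
  refine tendsto_nhds_unique (f := fun n => ∫ x, h x * ψ x * U n x) (l := atTop) ?_ ?_
  · refine Tendsto.congr hn (tendsto_finsetSum _ fun i _ => Tendsto.add ?_ ?_)
    -- The gradient term pairs Lᵖ with its dual; the two terms containing u itself use only that u
    -- is bounded.
    · have := (hconj i).ennrealOfReal
      refine tendsto_integral_mul_convolution_of_local (p := ENNReal.ofReal (p i))
        (q := ENNReal.ofReal (p i).conjExponent) ENNReal.ofReal_ne_top (hDu i).2
        (r := r) ?_ (fun x hx => by rw [hψr x hx, mul_zero]) hφ
      have hb : MemLp (fun x => (Metric.closedBall (0 : EuclideanSpace ℝ (Fin N)) r).indicator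
          (fun x => |Du i x| ^ (p i - 2) * Du i x) x) (ENNReal.ofReal (p i).conjExponent)
          volume :=
        (memLp_indicator_iff_restrict Metric.isClosed_closedBall.measurableSet).2
          (hAq i _ (isCompact_closedBall _ _))
      have hm := (hψ.continuous.memLp_top_of_hasCompactSupport hψc volume)
      refine (hb.mul (r := ENNReal.ofReal (p i).conjExponent) hm).congr_norm
        ((hAl i).aestronglyMeasurable.mul hψ.continuous.aestronglyMeasurable)
        (Eventually.of_forall fun x => ?_)
      by_cases hx : x ∈ Metric.closedBall (0 : EuclideanSpace ℝ (Fin N)) r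
      · simp [Set.indicator_of_mem hx]
        ring
      · simp [hψr x hx]
    · exact tendsto_integral_mul_convolution_of_bounded (hA2 i) hul hu hφ hφK
  · exact tendsto_integral_mul_convolution_of_bounded
      (hh.integrable_smul_right_of_hasCompactSupport hψ.continuous hψc) hul hu hφ hφK

/-! ### Cutoffs and pointwise inequalities -/

/-- Smooth cutoffs at scale `R` with gradient of size `1 / R`. -/
theorem exists_cutoff (N : ℕ) : ∃ B : ℝ, 0 < B ∧ ∀ R : ℝ, 0 < R →
    ∃ η : EuclideanSpace ℝ (Fin N) → ℝ, ContDiff ℝ 1 η ∧ HasCompactSupport η ∧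
      (∀ x, 0 ≤ η x) ∧ (∀ x, η x ≤ 1) ∧ (∀ x ∈ Metric.closedBall 0 R, η x = 1) ∧
      (∀ x, x ∉ Metric.closedBall 0 (2 * R) → η x = 0) ∧
      ∀ i x, |partialDeriv i η x| ≤ B / R := by
  let θ : ContDiffBump (0 : EuclideanSpace ℝ (Fin N)) := ⟨1, 2, one_pos, one_lt_two⟩
  have hθ : ContDiff ℝ 1 θ := θ.contDiff
  obtain ⟨B, hB⟩ := (hθ.continuous_fderiv one_ne_zero).bounded_above_of_compact_support
    (θ.hasCompactSupport.fderiv (𝕜 := ℝ))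
  have hB0 : 0 ≤ B := (norm_nonneg _).trans (hB 0)
  -- The bound B may be 0; adding 1 makes the constant positive.
  refine ⟨B + 1, by linarith, fun R hR => ⟨fun x => θ (R⁻¹ • x), ?_, ?_, fun x => θ.nonneg,
    fun x => θ.le_one, fun x hx => ?_, fun x hx => ?_, fun i x => ?_⟩⟩
  · exact hθ.comp (contDiff_const_smul _)
  · exact θ.hasCompactSupport.comp_homeomorph (Homeomorph.smulOfNeZero R⁻¹ (inv_ne_zero hR.ne'))
  · refine θ.one_of_mem_closedBall ?_
    rw [mem_closedBall_zero_iff] at hx ⊢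
    rw [norm_smul, Real.norm_of_nonneg (by positivity), inv_mul_le_iff₀ hR]
    simpa [θ] using hx
  · refine θ.zero_of_le_dist ?_
    rw [mem_closedBall_zero_iff, not_le] at hx
    rw [dist_zero_right, norm_smul, Real.norm_of_nonneg (by positivity), le_inv_mul_iff₀ hR]
    simp only [θ]
    linarith
  · have hd := (hθ.differentiable one_ne_zero (R⁻¹ • x)).hasFDerivAt.comp x
      ((hasFDerivAt_id x).const_smul R⁻¹)
    rw [partialDeriv]
    erw [hd.fderiv]
    have h1 : |fderiv ℝ θ (R⁻¹ • x) (EuclideanSpace.single i 1)| ≤ B := by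
      have := (fderiv ℝ θ (R⁻¹ • x)).le_of_opNorm_le (hB _) (EuclideanSpace.single i 1)
      simpa using this
    simp only [ContinuousLinearMap.comp_apply, _root_.smul_apply,
      ContinuousLinearMap.id_apply, map_smul, smul_eq_mul, abs_mul, abs_inv, abs_of_pos hR]
    rw [div_eq_inv_mul]
    gcongr
    exact h1.trans (by linarith)

/-- A Young inequality by dichotomy: if 2b ≤ ts, replace b by ts/2; otherwise ts < 2b, and s ≤ 1
lowers the power of s to p - 1. Here t stands for |∂ᵢu| and s for the cutoff; the factor 1/2 permits
absorption in `caccioppoli`. -/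
theorem rpow_sub_one_mul_le {t s b p : ℝ} (ht : 0 ≤ t) (hs : 0 ≤ s) (hs1 : s ≤ 1) (hb : 0 ≤ b)
    (hp : 2 < p) {j : ℕ} (hj : p ≤ 2 * j + 2) :
    t ^ (p - 1) * s ^ (2 * j + 1) * b ≤ t ^ p * s ^ (2 * j + 2) / 2 + 2 ^ (p - 1) * b ^ p := by
  have hpow : ∀ a : ℝ, 0 ≤ a → a ^ p = a ^ (p - 1) * a := fun a ha => by
    rw [← Real.rpow_add_one' ha (by linarith)]
    congr 1
    ring
  rcases le_or_gt (2 * b) (t * s) with h | h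
  · have h1 : t ^ (p - 1) * s ^ (2 * j + 1) * b ≤ t ^ (p - 1) * s ^ (2 * j + 1) * (t * s / 2) := by
      gcongr
      linarith
    have h2 : t ^ (p - 1) * s ^ (2 * j + 1) * (t * s / 2) = t ^ p * s ^ (2 * j + 2) / 2 := by
      rw [hpow t ht]
      ring
    have h3 : 0 ≤ 2 ^ (p - 1) * b ^ p := by positivity
    linarith
  · have h1 : s ^ (2 * j + 1) ≤ s ^ (p - 1) := by
      rw [← Real.rpow_natCast]
      refine Real.rpow_le_rpow_of_exponent_ge' hs hs1 (by linarith) ?_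
      push_cast
      linarith
    have h2 : t ^ (p - 1) * s ^ (2 * j + 1) * b ≤ (2 * b) ^ (p - 1) * b := by
      gcongr
      calc t ^ (p - 1) * s ^ (2 * j + 1) ≤ t ^ (p - 1) * s ^ (p - 1) := by gcongr
        _ = (t * s) ^ (p - 1) := (Real.mul_rpow ht hs).symm
        _ ≤ (2 * b) ^ (p - 1) := Real.rpow_le_rpow (by positivity) h.le (by linarith)
    rw [Real.mul_rpow zero_le_two hb, mul_assoc ((2 : ℝ) ^ (p - 1)), ← hpow b hb] at h2
    have h3 : 0 ≤ t ^ p * s ^ (2 * j + 2) / 2 := by positivity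
    linarith

/-- The same dichotomy, at b = ts. Nothing has to be absorbed in the stability inequality, so no
small factor is needed. -/
theorem rpow_sub_two_mul_le {t s b p : ℝ} (ht : 0 ≤ t) (hs : 0 ≤ s) (hs1 : s ≤ 1) (hb : 0 ≤ b)
    (hp : 2 < p) {j : ℕ} (hj : p ≤ 2 * j + 2) :
    t ^ (p - 2) * s ^ (2 * j) * b ^ 2 ≤ t ^ p * s ^ (2 * j + 2) + b ^ p := by
  have hpow : ∀ a : ℝ, 0 ≤ a → a ^ p = a ^ (p - 2) * a ^ 2 := fun a ha => by
    rw [← Real.rpow_natCast a 2, ← Real.rpow_add' ha (by norm_num; linarith)]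
    congr 1
    norm_num
  rcases le_or_gt b (t * s) with h | h
  · have h1 : t ^ (p - 2) * s ^ (2 * j) * b ^ 2 ≤ t ^ (p - 2) * s ^ (2 * j) * (t * s) ^ 2 := by
      gcongr
    have h2 : t ^ (p - 2) * s ^ (2 * j) * (t * s) ^ 2 = t ^ p * s ^ (2 * j + 2) := by
      rw [hpow t ht]
      ring
    have h3 : 0 ≤ b ^ p := by positivity
    linarith
  · have h1 : s ^ (2 * j) ≤ s ^ (p - 2) := by
      rw [← Real.rpow_natCast]
      refine Real.rpow_le_rpow_of_exponent_ge' hs hs1 (by linarith) ?_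
      push_cast
      linarith
    have h2 : t ^ (p - 2) * s ^ (2 * j) * b ^ 2 ≤ b ^ (p - 2) * b ^ 2 := by
      gcongr
      calc t ^ (p - 2) * s ^ (2 * j) ≤ t ^ (p - 2) * s ^ (p - 2) := by gcongr
        _ = (t * s) ^ (p - 2) := (Real.mul_rpow ht hs).symm
        _ ≤ b ^ (p - 2) := Real.rpow_le_rpow (by positivity) h.le (by linarith)
    rw [← hpow b hb] at h2
    have h3 : 0 ≤ t ^ p * s ^ (2 * j + 2) := by positivity
    linarith

theorem abs_rpow_sub_two_mul_self {p : ℝ} (hp : 2 < p) (a : ℝ) :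
    |(|a| ^ (p - 2) * a)| = |a| ^ (p - 1) := by
  rw [abs_mul, abs_of_nonneg (Real.rpow_nonneg (abs_nonneg _) _),
    ← Real.rpow_add_one' (abs_nonneg _) (by linarith)]
  congr 1
  ring

theorem abs_rpow_sub_two_mul_self_mul_self {p : ℝ} (hp : 2 < p) (a : ℝ) :
    |a| ^ (p - 2) * a * a = |a| ^ p := by
  rw [mul_assoc, ← abs_mul_abs_self a, ← mul_assoc, ← Real.rpow_add_one' (abs_nonneg _)
    (by linarith), ← Real.rpow_add_one' (abs_nonneg _) (by linarith)]
  congr 1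
  ring

theorem hasDerivAt_singularNonlinearity (δ γ : ℝ) {t : ℝ} (ht : 0 < t) :
    HasDerivAt (singularNonlinearity δ γ) (δ * t ^ (-δ - 1) + γ * t ^ (-γ - 1)) t := by
  have h := ((Real.hasDerivAt_rpow_const (p := -δ) (Or.inl ht.ne')).add
    (Real.hasDerivAt_rpow_const (p := -γ) (Or.inl ht.ne'))).neg
  convert! h using 1
  ring

/-- For t ≤ 1 the negative power in δ t^(-δ-1) is at least 1. This is where the upper bound u ≤ 1
enters the stability inequality. -/
theorem le_deriv_singularNonlinearity {δ γ : ℝ} (hδ : 0 ≤ δ) (hγ : 0 ≤ γ) {t : ℝ} (ht : 0 < t)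
    (ht1 : t ≤ 1) : δ ≤ deriv (singularNonlinearity δ γ) t := by
  rw [(hasDerivAt_singularNonlinearity δ γ ht).deriv]
  have h1 : 1 ≤ t ^ (-δ - 1) := Real.one_le_rpow_of_pos_of_le_one_of_nonpos ht ht1 (by linarith)
  have h2 : 0 ≤ γ * t ^ (-γ - 1) := by positivity
  nlinarith

theorem volume_real_closedBall_two_mul (N : ℕ) {R : ℝ} (hR : 0 < R) :
    volume.real (Metric.closedBall (0 : EuclideanSpace ℝ (Fin N)) (2 * R))
      = 2 ^ N * volume.real (Metric.closedBall (0 : EuclideanSpace ℝ (Fin N)) R) := by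
  rw [Measure.real, Measure.addHaar_closedBall_mul _ _ zero_le_two hR.le, ENNReal.toReal_mul,
    ENNReal.toReal_ofReal (by positivity), Measure.real]
  simp

/-! ### Caccioppoli and stability estimates -/

section Estimates

variable {N : ℕ} {p : Fin N → ℝ} {u : EuclideanSpace ℝ (Fin N) → ℝ}
  {Du : Fin N → EuclideanSpace ℝ (Fin N) → ℝ} {η : EuclideanSpace ℝ (Fin N) → ℝ} {j : ℕ}
  {b R : ℝ}

theorem HasAnisotropicWeakGradient.integrable_rpow_mul (hDu : HasAnisotropicWeakGradient p u Du)
    (hp : ∀ i, 2 < p i) {ψ : EuclideanSpace ℝ (Fin N) → ℝ} (hψ : Continuous ψ)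
    (hψc : HasCompactSupport ψ) (i : Fin N) :
    Integrable (fun x => |Du i x| ^ p i * ψ x) volume := by
  have h : LocallyIntegrable (fun x => |Du i x| ^ p i) volume := by
    rw [locallyIntegrable_iff]
    intro K hK
    have hpi : 0 < p i := by linarith [hp i]
    have := ((hDu i).2 K hK).integrable_norm_rpow (by simpa using hpi) ENNReal.ofReal_ne_top
    rw [ENNReal.toReal_ofReal hpi.le] at this
    exact this
  exact h.integrable_smul_right_of_hasCompactSupport hψ hψc

/-- The Caccioppoli inequality for bounded nonnegative subsolutions. -/
theorem caccioppoli (hp : ∀ i, 2 < p i) (hj : ∀ i, p i ≤ 2 * j + 2)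
    (hDu : HasAnisotropicWeakGradient p u Du) (hul : LocallyIntegrable u volume)
    (hu : ∀ᵐ x ∂volume, 0 < u x ∧ u x ≤ 1) {h : EuclideanSpace ℝ (Fin N) → ℝ}
    (hh : LocallyIntegrable h volume) (hh0 : ∀ᵐ x ∂volume, h x ≤ 0)
    (heq : ∀ φ : EuclideanSpace ℝ (Fin N) → ℝ, ContDiff ℝ 1 φ → HasCompactSupport φ →
      ∑ i, ∫ x, |Du i x| ^ (p i - 2) * Du i x * partialDeriv i φ x = ∫ x, h x * φ x)
    (hη : ContDiff ℝ 1 η) (hηc : HasCompactSupport η) (hη0 : ∀ x, 0 ≤ η x) (hη1 : ∀ x, η x ≤ 1)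
    (hηR : ∀ x, x ∉ Metric.closedBall 0 R → η x = 0) (hb : 0 ≤ b)
    (hηb : ∀ i x, (2 * j + 2) * |partialDeriv i η x| ≤ b) :
    ∑ i, ∫ x, |Du i x| ^ p i * η x ^ (2 * j + 2)
      ≤ 2 * ∑ i, 2 ^ (p i - 1) * b ^ p i *
        volume.real (Metric.closedBall (0 : EuclideanSpace ℝ (Fin N)) R) := by
  have hψ : ContDiff ℝ 1 (fun x => η x ^ (2 * j + 2)) := hη.pow _
  have hψc : HasCompactSupport (fun x => η x ^ (2 * j + 2)) :=
    hηc.comp_left (g := fun t : ℝ => t ^ (2 * j + 2)) (by simp)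
  have hu1 : ∀ᵐ x ∂volume, |u x| ≤ 1 := hu.mono fun x hx => by
    rw [abs_of_pos hx.1]
    exact hx.2
  have key := weak_equation_test_self hp hDu hul hu1 hh heq hψ hψc
  have hrhs : ∫ x, h x * η x ^ (2 * j + 2) * u x ≤ 0 := by
    refine integral_nonpos_of_ae ?_
    filter_upwards [hu, hh0] with x hx hx0
    exact mul_nonpos_of_nonpos_of_nonneg
      (mul_nonpos_of_nonpos_of_nonneg hx0 (pow_nonneg (hη0 x) _)) hx.1.le
  -- In each direction the cross term costs at most half of the energy, plus a volume term.
  have hterm : ∀ i, (∫ x, |Du i x| ^ p i * η x ^ (2 * j + 2)) / 2 - 2 ^ (p i - 1) * b ^ p i *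
        volume.real (Metric.closedBall (0 : EuclideanSpace ℝ (Fin N)) R)
      ≤ (∫ x, |Du i x| ^ (p i - 2) * Du i x * η x ^ (2 * j + 2) * Du i x)
        + ∫ x, |Du i x| ^ (p i - 2) * Du i x *
          partialDeriv i (fun x => η x ^ (2 * j + 2)) x * u x := by
    intro i
    have e1 : ∫ x, |Du i x| ^ (p i - 2) * Du i x * η x ^ (2 * j + 2) * Du i x
        = ∫ x, |Du i x| ^ p i * η x ^ (2 * j + 2) := by
      refine integral_congr_ae (Eventually.of_forall fun x => ?_)
      simp only
      rw [← abs_rpow_sub_two_mul_self_mul_self (hp i)]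
      ring
    have hi := hDu.integrable_rpow_mul hp hψ.continuous hψc i
    have hind : Integrable (fun x => (Metric.closedBall (0 : EuclideanSpace ℝ (Fin N)) R).indicator
        (fun _ => 2 ^ (p i - 1) * b ^ p i) x) volume :=
      (integrable_indicator_iff Metric.isClosed_closedBall.measurableSet).2
        (integrableOn_const (isCompact_closedBall _ _).measure_lt_top.ne)
    have e2 : |∫ x, |Du i x| ^ (p i - 2) * Du i x *
          partialDeriv i (fun x => η x ^ (2 * j + 2)) x * u x|
        ≤ (∫ x, |Du i x| ^ p i * η x ^ (2 * j + 2)) / 2 + 2 ^ (p i - 1) * b ^ p i *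
          volume.real (Metric.closedBall (0 : EuclideanSpace ℝ (Fin N)) R) := by
      have hle := norm_integral_le_of_norm_le
        (f := fun x => |Du i x| ^ (p i - 2) * Du i x *
          partialDeriv i (fun x => η x ^ (2 * j + 2)) x * u x) ((hi.div_const 2).add hind) ?_
      · simp only [Pi.add_apply] at hle
        rw [integral_add (hi.div_const 2) hind, integral_div,
          integral_indicator Metric.isClosed_closedBall.measurableSet, setIntegral_const,
          smul_eq_mul, mul_comm (volume.real _)] at hle
        exact hle
      · filter_upwards [hu1] with x hx
        rw [norm_mul, norm_mul, Real.norm_eq_abs, abs_rpow_sub_two_mul_self (hp i),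
          partialDeriv_pow i hη, Real.norm_eq_abs, Real.norm_eq_abs, abs_mul, abs_mul,
          abs_of_nonneg (pow_nonneg (hη0 x) _), Nat.abs_cast, Pi.add_apply]
        have hle1 : |Du i x| ^ (p i - 1) * (↑(2 * j + 2) * η x ^ (2 * j + 2 - 1)
            * |partialDeriv i η x|) * |u x| ≤ |Du i x| ^ (p i - 1) * η x ^ (2 * j + 1) * b := by
          calc _ ≤ |Du i x| ^ (p i - 1) * (↑(2 * j + 2) * η x ^ (2 * j + 2 - 1)
              * |partialDeriv i η x|) * 1 := by
                have := hη0 x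
                gcongr
            _ = |Du i x| ^ (p i - 1) * η x ^ (2 * j + 1)
                * ((2 * j + 2) * |partialDeriv i η x|) := by
              rw [show 2 * j + 2 - 1 = 2 * j + 1 by omega]
              push_cast
              ring
            _ ≤ _ := by
              have := hη0 x
              gcongr
              exact hηb i x
        refine hle1.trans ?_
        by_cases hxR : x ∈ Metric.closedBall (0 : EuclideanSpace ℝ (Fin N)) R
        · rw [Set.indicator_of_mem hxR]
          exact rpow_sub_one_mul_le (abs_nonneg _) (hη0 x) (hη1 x) hb (hp i) (hj i)
        · simp [hηR x hxR, Set.indicator_of_notMem hxR]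
    rw [e1]
    linarith [neg_abs_le (∫ x, |Du i x| ^ (p i - 2) * Du i x *
          partialDeriv i (fun x => η x ^ (2 * j + 2)) x * u x)]
  have hsum := (Finset.sum_le_sum fun i (_ : i ∈ Finset.univ) => hterm i).trans
    (key.trans_le hrhs)
  rw [Finset.sum_sub_distrib, ← Finset.sum_div] at hsum
  linarith

/-- The right-hand side of the stability inequality for a power of a cutoff. -/
theorem integral_rpow_mul_partialDeriv_pow_sq_le (hp : ∀ i, 2 < p i)
    (hj : ∀ i, p i ≤ 2 * j + 2) (hDu : HasAnisotropicWeakGradient p u Du)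
    (hη : ContDiff ℝ 1 η) (hηc : HasCompactSupport η) (hη0 : ∀ x, 0 ≤ η x) (hη1 : ∀ x, η x ≤ 1)
    (hηR : ∀ x, x ∉ Metric.closedBall 0 R → η x = 0) (hb : 0 ≤ b)
    (hηb : ∀ i x, (2 * j + 2) * |partialDeriv i η x| ≤ b) (i : Fin N) :
    ∫ x, |Du i x| ^ (p i - 2) * |partialDeriv i (fun x => η x ^ (j + 1)) x| ^ 2
      ≤ (∫ x, |Du i x| ^ p i * η x ^ (2 * j + 2))
        + b ^ p i * volume.real (Metric.closedBall (0 : EuclideanSpace ℝ (Fin N)) R) := by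
  have hψ : ContDiff ℝ 1 (fun x => η x ^ (2 * j + 2)) := hη.pow _
  have hψc : HasCompactSupport (fun x => η x ^ (2 * j + 2)) :=
    hηc.comp_left (g := fun t : ℝ => t ^ (2 * j + 2)) (by simp)
  have hi := hDu.integrable_rpow_mul hp hψ.continuous hψc i
  have hind : Integrable (fun x => (Metric.closedBall (0 : EuclideanSpace ℝ (Fin N)) R).indicator
      (fun _ => b ^ p i) x) volume :=
    (integrable_indicator_iff Metric.isClosed_closedBall.measurableSet).2
      (integrableOn_const (isCompact_closedBall _ _).measure_lt_top.ne)
  have hle : ∫ x, |Du i x| ^ (p i - 2) * |partialDeriv i (fun x => η x ^ (j + 1)) x| ^ 2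
      ≤ ∫ x, (|Du i x| ^ p i * η x ^ (2 * j + 2)
        + (Metric.closedBall (0 : EuclideanSpace ℝ (Fin N)) R).indicator
          (fun _ => b ^ p i) x) := by
    refine integral_mono_of_nonneg (Eventually.of_forall fun x => by positivity) (hi.add hind)
      (Eventually.of_forall fun x => ?_)
    simp only
    rw [partialDeriv_pow i hη, Nat.add_sub_cancel, abs_mul, abs_mul,
      abs_of_nonneg (pow_nonneg (hη0 x) _), Nat.abs_cast]
    have hle1 : |Du i x| ^ (p i - 2) * (↑(j + 1) * η x ^ j * |partialDeriv i η x|) ^ 2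
        ≤ |Du i x| ^ (p i - 2) * η x ^ (2 * j) * b ^ 2 := by
      have hjb : ↑(j + 1) * |partialDeriv i η x| ≤ b := by
        refine le_trans ?_ (hηb i x)
        gcongr
        push_cast
        have : (0 : ℝ) ≤ j := j.cast_nonneg
        linarith
      calc _ = |Du i x| ^ (p i - 2) * η x ^ (2 * j) * (↑(j + 1) * |partialDeriv i η x|) ^ 2 := by
            ring
        _ ≤ _ := by
          have := hη0 x
          gcongr
    refine hle1.trans ?_
    by_cases hxR : x ∈ Metric.closedBall (0 : EuclideanSpace ℝ (Fin N)) R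
    · rw [Set.indicator_of_mem hxR]
      exact rpow_sub_two_mul_le (abs_nonneg _) (hη0 x) (hη1 x) hb (hp i) (hj i)
    -- The factor η^(2j) vanishes off the ball only if j ≠ 0, which 2 < pᵢ ≤ 2j + 2 guarantees.
    · have hpos : j ≠ 0 := by
        rintro rfl
        have h1 := hp i
        have h2 := hj i
        norm_num at h2
        linarith
      simp [hηR x hxR, Set.indicator_of_notMem hxR, hpos]
  rw [integral_add hi hind, integral_indicator Metric.isClosed_closedBall.measurableSet,
    setIntegral_const, smul_eq_mul, mul_comm (volume.real _)] at hle
  exact hle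

end Estimates

/-! ### Decay and contradiction -/

/-- The energy of a stable solution with values in `(0, 1]` decays faster than the volume grows. -/
theorem stable_solution_decay {N : ℕ} {p : Fin N → ℝ} (hp : ∀ i, 2 < p i)
    {g : EuclideanSpace ℝ (Fin N) → ℝ} {c : ℝ} (hc : 0 < c) (hgc : ∀ᵐ x ∂volume, c ≤ g x)
    {δ γ : ℝ} (hδ : 0 < δ) (hγ : 0 < γ) {u : EuclideanSpace ℝ (Fin N) → ℝ}
    (hu : ∀ᵐ x ∂volume, 0 < u x ∧ u x ≤ 1)
    (hstab : IsStableSolution p g (singularNonlinearity δ γ) u) :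
    ∃ C : ℝ, ∀ b : ℝ, 0 < b → b ≤ 1 → c * δ ≤ C * b ^ 2 := by
  obtain ⟨hul, -, hf, hf', Du, hDu, heq, hst⟩ := hstab
  obtain ⟨B, hB, hcut⟩ := exists_cutoff N
  set P : ℝ := ∑ i, p i
  have hpP : ∀ i, p i ≤ P := fun i =>
    Finset.single_le_sum (fun k _ => by linarith [hp k]) (Finset.mem_univ i)
  obtain ⟨j, hj⟩ := exists_nat_ge P
  have hP : 0 ≤ P := Finset.sum_nonneg fun k _ => by linarith [hp k]
  have hj' : ∀ i, p i ≤ 2 * j + 2 := fun i => by linarith [hpP i]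
  refine ⟨3 * P * (∑ i, 2 ^ (p i - 1)) * 2 ^ N, fun b hb hb1 => ?_⟩
  -- Chosen so that (2j+2)·B/R = b. The cutoff lives on the ball of radius 2R, hence the factors 2^N
  -- below.
  set R : ℝ := (2 * j + 2) * B / b
  have hR : 0 < R := by positivity
  obtain ⟨η, hη, hηc, hη0, hη1, hηone, hηR, hηd⟩ := hcut R hR
  have hηb : ∀ i x, (2 * j + 2) * |partialDeriv i η x| ≤ b := fun i x => by
    calc (2 * j + 2) * |partialDeriv i η x| ≤ (2 * j + 2) * (B / R) := by
          gcongr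
          exact hηd i x
      _ = b := by
        simp only [R]
        field_simp
  set V : ℝ := volume.real (Metric.closedBall (0 : EuclideanSpace ℝ (Fin N)) R) with hVdef
  have hV : 0 < V := ENNReal.toReal_pos (Metric.measure_closedBall_pos _ _ hR).ne'
    (isCompact_closedBall _ _).measure_lt_top.ne
  have hcacc := caccioppoli hp hj' hDu hul hu hf (by
    filter_upwards [hu, hgc] with x hx hgx
    have h1 : 0 < u x ^ (-δ) := Real.rpow_pos_of_pos hx.1 _
    have h2 : 0 < u x ^ (-γ) := Real.rpow_pos_of_pos hx.1 _
    exact mul_nonpos_of_nonneg_of_nonpos (by linarith)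
      (by rw [singularNonlinearity]; linarith)) heq hη hηc hη0 hη1 hηR hb.le hηb
  have hψ : ContDiff ℝ 1 (fun x => η x ^ (j + 1)) := hη.pow _
  have hψc : HasCompactSupport (fun x => η x ^ (j + 1)) :=
    hηc.comp_left (g := fun t : ℝ => t ^ (j + 1)) (by simp)
  have hstψ := hst _ hψ hψc
  rw [volume_real_closedBall_two_mul N hR, ← hVdef] at hcacc
  have hlower : c * δ * V
      ≤ ∫ x, g x * deriv (singularNonlinearity δ γ) (u x) * (η x ^ (j + 1)) ^ 2 := by
    have hint : Integrable (fun x => g x * deriv (singularNonlinearity δ γ) (u x)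
        * (η x ^ (j + 1)) ^ 2) volume :=
      hf'.integrable_smul_right_of_hasCompactSupport (hψ.continuous.pow 2)
        (hψc.comp_left (g := fun t : ℝ => t ^ 2) (by simp))
    have hV' : c * δ * V = ∫ x, (Metric.closedBall (0 : EuclideanSpace ℝ (Fin N)) R).indicator
        (fun _ => c * δ) x := by
      rw [integral_indicator Metric.isClosed_closedBall.measurableSet, setIntegral_const,
        smul_eq_mul, mul_comm]
    rw [hV']
    refine integral_mono_ae ((integrable_indicator_iff
      Metric.isClosed_closedBall.measurableSet).2
        (integrableOn_const (isCompact_closedBall _ _).measure_lt_top.ne)) hint ?_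
    filter_upwards [hu, hgc] with x hx hgx
    have hd := le_deriv_singularNonlinearity hδ.le hγ.le hx.1 hx.2
    by_cases hxR : x ∈ Metric.closedBall (0 : EuclideanSpace ℝ (Fin N)) R
    · rw [Set.indicator_of_mem hxR, hηone x hxR, one_pow, one_pow, mul_one]
      exact mul_le_mul hgx hd hδ.le (hc.le.trans hgx)
    · rw [Set.indicator_of_notMem hxR]
      exact mul_nonneg (mul_nonneg (hc.le.trans hgx) (hδ.le.trans hd)) (sq_nonneg _)
  have hupper : ∑ i, (p i - 1) * ∫ x, |Du i x| ^ (p i - 2)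
        * |partialDeriv i (fun x => η x ^ (j + 1)) x| ^ 2
      ≤ P * ((∑ i, ∫ x, |Du i x| ^ p i * η x ^ (2 * j + 2))
        + ∑ i, 2 ^ (p i - 1) * b ^ p i * (2 ^ N * V)) := by
    rw [← Finset.sum_add_distrib, Finset.mul_sum]
    refine Finset.sum_le_sum fun i _ => ?_
    have h1 := integral_rpow_mul_partialDeriv_pow_sq_le hp hj' hDu hη hηc hη0 hη1 hηR hb.le hηb i
    rw [volume_real_closedBall_two_mul N hR, ← hVdef] at h1
    have h2 : b ^ p i * (2 ^ N * V) ≤ 2 ^ (p i - 1) * b ^ p i * (2 ^ N * V) := by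
      have : (1 : ℝ) ≤ 2 ^ (p i - 1) := Real.one_le_rpow one_le_two (by linarith [hp i])
      rw [mul_assoc]
      exact le_mul_of_one_le_left (by positivity) this
    refine mul_le_mul (by linarith [hpP i]) (h1.trans (by linarith)) ?_ hP
    exact integral_nonneg fun x => by positivity
  have hpow : ∑ i, 2 ^ (p i - 1) * b ^ p i * (2 ^ N * V)
      ≤ (∑ i, 2 ^ (p i - 1)) * b ^ 2 * (2 ^ N * V) := by
    rw [Finset.sum_mul, Finset.sum_mul]
    refine Finset.sum_le_sum fun i _ => ?_
    gcongr
    -- Since b ≤ 1 and pᵢ > 2, all the powers b^{pᵢ} are at most b².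
    rw [← Real.rpow_natCast]
    exact Real.rpow_le_rpow_of_exponent_ge hb hb1 (by exact_mod_cast (hp i).le)
  -- The 3 is 2 from `caccioppoli` plus 1 from the volume term of the stability estimate.
  have hfinal : c * δ * V ≤ 3 * P * (∑ i, 2 ^ (p i - 1)) * 2 ^ N * b ^ 2 * V :=
    calc c * δ * V ≤ _ := hlower.trans (hstψ.trans hupper)
      _ ≤ P * (3 * ((∑ i, 2 ^ (p i - 1)) * b ^ 2 * (2 ^ N * V))) := by
        gcongr
        linarith
      _ = _ := by ring
  exact le_of_mul_le_mul_right hfinal hV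

theorem theorem3p2 (N : ℕ) [NeZero N]
    (p : Fin N → ℝ) (hp : ∀ i, 2 < p i) (hp_mono : Monotone p)
    (g : EuclideanSpace ℝ (Fin N) → ℝ) (hg : LocallyIntegrable g volume)
    (c : ℝ) (hc : 0 < c) (hgc : ∀ᵐ x ∂volume, c ≤ g x)
    (δ γ : ℝ) (hδ : 1 ≤ δ) (hδγ : δ < γ)
    (hden : ∀ i, 0 < denomI p i)
    (hδ_mem : δ ∈ intervalA p ∩ intervalI p)
    (u : EuclideanSpace ℝ (Fin N) → ℝ) (hu : MemAnisotropicSobolevLoc p u)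
    (hu01 : ∀ᵐ x ∂volume, 0 < u x ∧ u x ≤ 1) :
    ¬ IsStableSolution p g (singularNonlinearity δ γ) u := by
  intro hstab
  obtain ⟨C, hC⟩ := stable_solution_decay hp hc hgc (by linarith) (by linarith) hu01 hstab
  -- Letting b → 0⁺ amounts to letting the cutoff radius tend to infinity.
  have hlim : Tendsto (fun b : ℝ => C * b ^ 2) (𝓝[>] 0) (𝓝 0) := by
    have : Continuous fun b : ℝ => C * b ^ 2 := by fun_prop
    simpa using (this.tendsto 0).mono_left nhdsWithin_le_nhds
  have h0 : c * δ ≤ 0 := by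
    refine ge_of_tendsto hlim ?_
    filter_upwards [Ioc_mem_nhdsGT (zero_lt_one (α := ℝ))] with b hb
    exact hC b hb.1 hb.2
  have : 0 < c * δ := mul_pos hc (by linarith)
  linarith
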